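/- Let $H:\mathbf{Set}\to\mathbf{Set}$ be an endofunctor. An $H$-algebra is a map $a:HA\to A$, an $H$-coalgebra is a map $e:X\to HX$, and $\mathsf{Alg}\,H$, $\mathsf{Coalg}\,H$ denote the categories of these with the usual homomorphisms. An algebra $(A,a)$ is called corecursive if for every coalgebra $e:X\to HX$ there is a unique map $e^\dagger:X\to A$ with $e^\dagger=a\cdot He^\dagger\cdot e$. A free algebra on a set $Y$ is an algebra $FY$ with a map $\eta:Y\to FY$ such that every map from $Y$ to (the carrier of) an algebra $B$ factorizes through $\eta$ by a unique homomorphism $FY\to B$. A free corecursive algebra on $Y$ is a corecursive algebra $MY$ with a map $Y\to MY$ having the same universal property with respect to all corecursive algebras $B$. A pre-fixpoint of $H$ is a set $A$ for which there is an injective map $HA\to A$. A corecursive fixpoint is a corecursive algebra $a:HA\to A$ with $a$ bijective. Theorem. For every endofunctor $H$ of $\mathbf{Set}$ the following are equivalent: (i) every set $Y$ has a free corecursive algebra; (ii) every set $Y$ has a free algebra, and $H$ has a terminal coalgebra; (iii) for every cardinal $\kappa$ there is a pre-fixpoint of $H$ of cardinality at least $\kappa$, and $H$ has a corecursive fixpoint.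 If these conditions hold, then for every terminal coalgebra $\tau:T\to HT$ (considered as the algebra $\tau^{-1}:HT\to T$), every set $Y$ and every free algebra $FY$ on $Y$ with universal map $\eta:Y\to FY$, the coproduct $T\oplus FY$ in $\mathsf{Alg}\,H$ exists, and it is a free corecursive algebra on $Y$ with universal map $\mathsf{inr}\cdot\eta$, where $\mathsf{inr}:FY\to T\oplus FY$ is the coproduct injection. -/

import Mathlib

open CategoryTheory CategoryTheory.Endofunctor CategoryTheory.Limits

universe u

namespace SetFunctor

/-- The algebra `A` is corecursive: every coalgebra `e : X ⟶ H X` has a unique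
coalgebra-to-algebra morphism (solution) into `A`. -/
def IsCorecursive {H : Type u ⥤ Type u} (A : Endofunctor.Algebra H) : Prop :=
  ∀ X : Endofunctor.Coalgebra H, ∃! s : X.V ⟶ A.a, s = X.str ≫ H.map s ≫ A.str

/-- `F` is a free algebra on the set `Y` with universal arrow `η`. -/
def IsFreeAlgebra {H : Type u ⥤ Type u} {Y : Type u} (F : Endofunctor.Algebra H)
    (η : Y ⟶ F.a) : Prop :=
  ∀ (B : Endofunctor.Algebra H) (g : Y ⟶ B.a), ∃! h : F ⟶ B, η ≫ h.f = g

/-- `M` is a free corecursive algebra on the set `Y` with universal arrow `η`: it is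
corecursive, and universal among the corecursive algebras, which form a full subcategory of
the category of algebras. -/
def IsFreeCorecursiveAlgebra {H : Type u ⥤ Type u} {Y : Type u} (M : Endofunctor.Algebra H)
    (η : Y ⟶ M.a) : Prop :=
  IsCorecursive M ∧
    ∀ B : Endofunctor.Algebra H, IsCorecursive B →
      ∀ g : Y ⟶ B.a, ∃! h : M ⟶ B, η ≫ h.f = g

/-- Every set generates a free algebra. -/
def HasFreeAlgebras (H : Type u ⥤ Type u) : Prop :=
  ∀ Y : Type u, ∃ (F : Endofunctor.Algebra H) (η : Y ⟶ F.a), IsFreeAlgebra F η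

/-- Every set generates a free corecursive algebra. -/
def HasFreeCorecursiveAlgebras (H : Type u ⥤ Type u) : Prop :=
  ∀ Y : Type u, ∃ (M : Endofunctor.Algebra H) (η : Y ⟶ M.a), IsFreeCorecursiveAlgebra M η

/-- `A` is a pre-fixpoint: `H A` is a subobject of `A`. -/
def IsPreFixpoint (H : Type u ⥤ Type u) (A : Type u) : Prop :=
  ∃ m : H.obj A ⟶ A, Mono m

/-- There are pre-fixpoints of arbitrarily large cardinality. -/
def HasArbitrarilyLargePreFixpoints (H : Type u ⥤ Type u) : Prop :=
  ∀ κ : Cardinal.{u}, ∃ A : Type u, κ ≤ Cardinal.mk A ∧ IsPreFixpoint H A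

/-- There is an isomorphism `H A ≅ A` that is a corecursive algebra. -/
def HasCorecursiveFixpoint (H : Type u ⥤ Type u) : Prop :=
  ∃ A : Endofunctor.Algebra H, IsIso A.str ∧ IsCorecursive A

/-- A terminal coalgebra `τ : T ⟶ H T`, considered as the algebra `τ⁻¹ : H T ⟶ T`. -/
def terminalAlgebra {H : Type u ⥤ Type u} {T : Endofunctor.Coalgebra H} (hT : IsTerminal T) :
    Endofunctor.Algebra H where
  a := T.V
  str := Endofunctor.Coalgebra.Terminal.strInv hT

end SetFunctor

/-!
The equivalence rests on one construction and one fixpoint argument.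

*Construction.* Let `P` be a coalgebra for `G` which embeds, by a coalgebra-to-algebra morphism
("solution"), in an algebra `A` with injective structure map. Then there is an algebra with a
universal solution of `P` (`exists_free_algebra_over`). It is a subalgebra of `A`: the subsets of
`A` that contain `P`, are coalgebras, and on which solutions of `P` extend uniquely are closed
under unions of chains and under one application of the structure map, so a maximal one, given by
Zorn's lemma, is closed under the structure map. This takes the place of a transfinite
free-algebra chain. For `G = H + Y` it yields the free `H`-algebra on `Y` over `P`
(`IsFreeOver`): the free algebra `FY` when `P` is empty, and the coproduct `T ⊕ FY` when `P` is
the terminal coalgebra `T`. If `H` has pre-fixpoints `H K ↪ K` with `K` infinite and at least as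
large as `P` and `Y`, then `K ≅ K + K` provides the required algebra `A`
(`HasArbitrarilyLargePreFixpoints.exists_embedding`).

*Lambek's lemma.* Both for free and for free corecursive algebras `A` on `Y`, the canonical map
`H A + Y ⟶ A` is bijective (`bijective_of_section`); in the corecursive case this uses that
`H A + Y` is corecursive when `A` is (`IsCorecursive.unfoldAlgebra`). So each of these free
algebras is a pre-fixpoint at least as large as `Y`, and the free corecursive algebra on the empty
set is a corecursive fixpoint. Corecursive fixpoints and terminal coalgebras are the same thing
up to inversion of the structure map.

*Corecursiveness of `T ⊕ FY`.* Every coalgebra has a solution in `T`, hence in `V = T ⊕ FY`. It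
is unique, because every solution `s` in `V` takes its values in `T`
(`IsFreeOver.mem_range_of_isSolution`): the elements of `T` together with those that are not
values of `s` form a subalgebra containing `T` and `Y`, which is all of `V`. Finally, `T` has a
unique solution in every corecursive algebra, so the universal property of the coproduct is that
of a free corecursive algebra.
-/

namespace SetFunctor

/-! ### Elements supported on a subset -/

/-- The elements of `G A` supported on `S ⊆ A`: the image of `G S` in `G A`. The inclusion
`S ⊆ A` need not induce an injection `G S → G A` when `S` is empty, so this image is used in
place of `G S`. -/
def supportedOn (G : Type u ⥤ Type u) {A : Type u} (S : Set A) : Set (G.obj A) :=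
  Set.range (G.map (TypeCat.ofHom (Subtype.val : S → A)))

theorem mem_supportedOn_of_factors (G : Type u ⥤ Type u) {A X : Type u} {S : Set A} (f : X ⟶ A)
    (hf : ∀ x, f x ∈ S) (z : G.obj X) : G.map f z ∈ supportedOn G S := by
  refine ⟨G.map (TypeCat.ofHom fun x => (⟨f x, hf x⟩ : S)) z, ?_⟩
  rw [← Functor.map_comp_apply]
  rfl

theorem supportedOn_mono (G : Type u ⥤ Type u) {A : Type u} {S S' : Set A} (h : S ⊆ S') :
    supportedOn G S ⊆ supportedOn G S' := by
  rintro _ ⟨z, rfl⟩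
  exact mem_supportedOn_of_factors G _ (fun x => h x.2) z

theorem map_eq_of_eqOn (G : Type u ⥤ Type u) {A B : Type u} {S : Set A} {f f' : A ⟶ B}
    (h : ∀ a ∈ S, f a = f' a) {z : G.obj A} (hz : z ∈ supportedOn G S) :
    G.map f z = G.map f' z := by
  obtain ⟨w, rfl⟩ := hz
  rw [← Functor.map_comp_apply, ← Functor.map_comp_apply]
  have hS : TypeCat.ofHom (Subtype.val : S → A) ≫ f = TypeCat.ofHom Subtype.val ≫ f' :=
    ConcreteCategory.hom_ext _ _ fun x => h x x.2
  rw [hS]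

/-- A functor on sets preserves injections with a nonempty domain, since these split. -/
theorem map_injective (G : Type u ⥤ Type u) {X A : Type u} [Nonempty X] {f : X ⟶ A}
    (hf : Function.Injective f) : Function.Injective (G.map f) := by
  intro z w hzw
  have hid : f ≫ TypeCat.ofHom (Function.invFun f) = 𝟙 X := by
    ext x
    exact Function.leftInverse_invFun hf x
  have key : ∀ z, G.map (TypeCat.ofHom (Function.invFun f)) (G.map f z) = z := by
    intro z
    rw [← Functor.map_comp_apply, hid, Functor.map_id_apply]
  rw [← key z, ← key w, hzw]

theorem exists_extension {X A B : Type u} [Nonempty B] {t : X ⟶ A} (ht : Function.Injective t)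
    (g : X ⟶ B) : ∃ f : A ⟶ B, t ≫ f = g :=
  ⟨TypeCat.ofHom (Function.extend t g fun _ => Classical.arbitrary B),
    ConcreteCategory.hom_ext _ _ fun x =>
      ht.extend_apply g (fun _ => Classical.arbitrary B) x⟩

/-! ### Solutions of coalgebras in algebras -/

/-- `s` is a solution of the coalgebra `P` in the algebra `B`, that is, a
coalgebra-to-algebra morphism. -/
def IsSolution {G : Type u ⥤ Type u} (P : Endofunctor.Coalgebra G) (B : Endofunctor.Algebra G)
    (s : P.V ⟶ B.a) : Prop :=
  s = P.str ≫ G.map s ≫ B.str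

theorem IsSolution.apply {G : Type u ⥤ Type u} {P : Endofunctor.Coalgebra G}
    {B : Endofunctor.Algebra G} {s : P.V ⟶ B.a} (hs : IsSolution P B s) (x : P.V) :
    s x = B.str (G.map s (P.str x)) :=
  ConcreteCategory.congr_hom hs x

theorem IsSolution.comp {G : Type u ⥤ Type u} {P : Endofunctor.Coalgebra G}
    {B C : Endofunctor.Algebra G} {s : P.V ⟶ B.a} (hs : IsSolution P B s) (h : B ⟶ C) :
    IsSolution P C (s ≫ h.f) := by
  unfold IsSolution at *
  rw [G.map_comp, Category.assoc, h.h]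
  nth_rewrite 1 [hs]
  simp only [Category.assoc]

theorem hom_apply {G : Type u ⥤ Type u} {B C : Endofunctor.Algebra G} (h : B ⟶ C)
    (z : G.obj B.a) : h.f (B.str z) = C.str (G.map h.f z) :=
  (ConcreteCategory.congr_hom h.h z).symm

/-! ### The free algebra over a coalgebra embedded in an algebra -/

section Zorn

variable {G : Type u ⥤ Type u} {P : Endofunctor.Coalgebra G} {A : Endofunctor.Algebra G}

/-- `f` is a solution in `B` of the structure that `A` induces on its subset `S`. Only the
restriction of `f` to `S` matters; `f` is defined on all of `A` so that solutions on
different subsets can be compared. -/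
def IsSolutionOn (A B : Endofunctor.Algebra G) (S : Set A.a) (f : A.a ⟶ B.a) : Prop :=
  ∀ z ∈ supportedOn G S, A.str z ∈ S → f (A.str z) = B.str (G.map f z)

theorem IsSolutionOn.mono {B : Endofunctor.Algebra G} {S S' : Set A.a} {f : A.a ⟶ B.a}
    (hf : IsSolutionOn A B S' f) (h : S ⊆ S') : IsSolutionOn A B S f :=
  fun z hz hz' => hf z (supportedOn_mono G h hz) (h hz')

/-- A subset `S` of `A` containing the image of `P` is a stage over `t : P ⟶ A` if each of its
elements is obtained from `S` by the structure map, so that `S` is a coalgebra when this map is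
injective, and if every solution of `P` has a unique extension to a solution on `S`. The stages
are the subsets that a transfinite iteration of `S ↦ A.str (G S)` from the image of `P` would
produce. -/
structure IsStage (t : P.V ⟶ A.a) (S : Set A.a) : Prop where
  base_mem : ∀ p, t p ∈ S
  generated : ∀ a ∈ S, ∃ z ∈ supportedOn G S, A.str z = a
  exists_solution : ∀ (B : Endofunctor.Algebra G) (g : P.V ⟶ B.a), IsSolution P B g →
    ∃ f : A.a ⟶ B.a, IsSolutionOn A B S f ∧ t ≫ f = g
  solution_unique : ∀ (B : Endofunctor.Algebra G) (f f' : A.a ⟶ B.a), IsSolutionOn A B S f →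
    IsSolutionOn A B S f' → t ≫ f = t ≫ f' → ∀ a ∈ S, f a = f' a

variable {t : P.V ⟶ A.a}

theorem nonempty_of_isSolution [hP : Nonempty (G.obj P.V)] {B : Endofunctor.Algebra G}
    (g : P.V ⟶ B.a) : Nonempty B.a :=
  hP.map fun z => B.str (G.map g z)

theorem isStage_range [Nonempty (G.obj P.V)] (hA : Function.Injective A.str)
    (ht : IsSolution P A t) (hinj : Function.Injective t) : IsStage t (Set.range t) where
  base_mem p := ⟨p, rfl⟩
  generated := by
    rintro _ ⟨p, rfl⟩
    exact ⟨G.map t (P.str p),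
      mem_supportedOn_of_factors G t (fun x => Set.mem_range_self x) (P.str p),
      (ht.apply p).symm⟩
  exists_solution B g hg := by
    have := nonempty_of_isSolution g
    obtain ⟨f, hext⟩ := exists_extension hinj g
    refine ⟨f, ?_, hext⟩
    rintro z - ⟨p, hp⟩
    have hz : z = G.map t (P.str p) := hA (hp.symm.trans (ht.apply p))
    rw [hz, ← Functor.map_comp_apply, hext, ← hg.apply p, ← ht.apply p]
    exact ConcreteCategory.congr_hom hext p
  solution_unique B f f' _ _ h := by
    rintro _ ⟨p, rfl⟩
    exact ConcreteCategory.congr_hom h p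

theorem IsStage.subset_image {S : Set A.a} (hS : IsStage t S) :
    S ⊆ A.str '' supportedOn G S := hS.generated

/-- The successor step: one application of the structure map turns a stage into a stage. -/
theorem IsStage.image (hA : Function.Injective A.str) {S : Set A.a} (hS : IsStage t S) :
    IsStage t (A.str '' supportedOn G S) where
  base_mem p := hS.subset_image (hS.base_mem p)
  generated := by
    rintro _ ⟨z, hz, rfl⟩
    exact ⟨z, supportedOn_mono G hS.subset_image hz, rfl⟩
  exists_solution B g hg := by
    classical
    obtain ⟨f, hf, hfg⟩ := hS.exists_solution B g hg
    let f' : A.a ⟶ B.a := TypeCat.ofHom fun a =>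
      if h : ∃ z ∈ supportedOn G S, A.str z = a then B.str (G.map f h.choose) else f a
    have hf' : ∀ z ∈ supportedOn G S, f' (A.str z) = B.str (G.map f z) := by
      intro z hz
      have h : ∃ w ∈ supportedOn G S, A.str w = A.str z := ⟨z, hz, rfl⟩
      have hw : h.choose = z := hA h.choose_spec.2
      change (if h : ∃ w ∈ supportedOn G S, A.str w = A.str z then
        B.str (G.map f h.choose) else f (A.str z)) = _
      rw [dif_pos h, hw]
    have hff' : ∀ a ∈ S, f' a = f a := by
      intro a ha
      obtain ⟨z, hz, rfl⟩ := hS.generated a ha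
      rw [hf' z hz, hf z hz ha]
    refine ⟨f', ?_, ?_⟩
    · rintro z - ⟨w, hw, hwz⟩
      obtain rfl := hA hwz
      rw [hf' w hw, map_eq_of_eqOn G hff' hw]
    · rw [← hfg]
      ext p
      exact hff' _ (hS.base_mem p)
  solution_unique B f f' hf hf' h := by
    rintro _ ⟨z, hz, rfl⟩
    have heq := hS.solution_unique B f f' (hf.mono hS.subset_image) (hf'.mono hS.subset_image) h
    have hz' := supportedOn_mono G hS.subset_image hz
    rw [hf z hz' ⟨z, hz, rfl⟩, hf' z hz' ⟨z, hz, rfl⟩, map_eq_of_eqOn G heq hz]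

/-- The limit step: on a chain of stages the solutions extending a given one agree, and so
they glue. -/
theorem IsStage.sUnion [Nonempty (G.obj P.V)] (hA : Function.Injective A.str)
    {c : Set (Set A.a)} (hc : ∀ S ∈ c, IsStage t S) (hchain : IsChain (· ⊆ ·) c)
    (hne : c.Nonempty) : IsStage t (⋃₀ c) where
  base_mem p := by
    obtain ⟨S, hS⟩ := hne
    exact ⟨S, hS, (hc S hS).base_mem p⟩
  generated := by
    rintro a ⟨S, hS, ha⟩
    obtain ⟨z, hz, rfl⟩ := (hc S hS).generated a ha
    exact ⟨z, supportedOn_mono G (Set.subset_sUnion_of_mem hS) hz, rfl⟩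
  exists_solution B g hg := by
    classical
    have := nonempty_of_isSolution g
    have : Nonempty (A.a ⟶ B.a) := ⟨TypeCat.ofHom fun _ => Classical.arbitrary _⟩
    choose! F hF hFg using fun S (hS : S ∈ c) => (hc S hS).exists_solution B g hg
    have hcompat : ∀ S ∈ c, ∀ S' ∈ c, ∀ a ∈ S, a ∈ S' → F S a = F S' a := by
      intro S hS S' hS' a ha ha'
      have hFF : t ≫ F S = t ≫ F S' := (hFg S hS).trans (hFg S' hS').symm
      rcases hchain.total hS hS' with h | h
      · exact (hc S hS).solution_unique B _ _ (hF S hS) ((hF S' hS').mono h) hFF a ha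
      · exact (hc S' hS').solution_unique B _ _ ((hF S hS).mono h) (hF S' hS') hFF a ha'
    let f : A.a ⟶ B.a := TypeCat.ofHom fun a =>
      if h : ∃ S ∈ c, a ∈ S then F h.choose a else Classical.arbitrary _
    have hf : ∀ S ∈ c, ∀ a ∈ S, f a = F S a := by
      intro S hS a ha
      have h : ∃ S ∈ c, a ∈ S := ⟨S, hS, ha⟩
      change (if h : ∃ S ∈ c, a ∈ S then F h.choose a else Classical.arbitrary _) = _
      rw [dif_pos h]
      exact hcompat _ h.choose_spec.1 _ hS a h.choose_spec.2 ha
    refine ⟨f, ?_, ?_⟩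
    · rintro z - ⟨S, hS, hzS⟩
      obtain ⟨w, hw, hwz⟩ := (hc S hS).generated _ hzS
      obtain rfl := hA hwz
      rw [hf S hS _ hzS, hF S hS w hw hzS, map_eq_of_eqOn G (hf S hS) hw]
    · obtain ⟨S, hS⟩ := hne
      rw [← hFg S hS]
      ext p
      exact hf S hS _ ((hc S hS).base_mem p)
  solution_unique B f f' hf hf' h := by
    rintro a ⟨S, hS, ha⟩
    exact (hc S hS).solution_unique B f f' (hf.mono (Set.subset_sUnion_of_mem hS))
      (hf'.mono (Set.subset_sUnion_of_mem hS)) h a ha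

/-- A stage closed under the structure map is a subalgebra of `A`, and it is the free algebra
over the coalgebra `P`. -/
theorem IsStage.exists_free_of_closed [Nonempty (G.obj P.V)]
    (ht : IsSolution P A t) {S : Set A.a} (hS : IsStage t S)
    (hclosed : ∀ z ∈ supportedOn G S, A.str z ∈ S) :
    ∃ (V : Endofunctor.Algebra G) (j : P.V ⟶ V.a), IsSolution P V j ∧
      ∀ (B : Endofunctor.Algebra G) (g : P.V ⟶ B.a), IsSolution P B g →
        ∃! h : V ⟶ B, j ≫ h.f = g := by
  let i : (S : Type u) ⟶ A.a := TypeCat.ofHom Subtype.val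
  let V : Endofunctor.Algebra G :=
    { a := S
      str := TypeCat.ofHom fun z => ⟨A.str (G.map i z), hclosed _ ⟨z, rfl⟩⟩ }
  let j : P.V ⟶ V.a := TypeCat.ofHom fun p => ⟨t p, hS.base_mem p⟩
  have hji : j ≫ i = t := rfl
  have hV : ∀ z, i (V.str z) = A.str (G.map i z) := fun z => rfl
  refine ⟨V, j, ?_, ?_⟩
  · refine ConcreteCategory.hom_ext _ _ fun p => Subtype.ext ?_
    change i (j p) = i (V.str (G.map j (P.str p)))
    rw [hV, ← Functor.map_comp_apply, hji, ← ht.apply p]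
    rfl
  · intro B g hg
    have := nonempty_of_isSolution g
    obtain ⟨f, hf, hfg⟩ := hS.exists_solution B g hg
    refine ⟨{ f := i ≫ f, h := ?_ }, ?_, ?_⟩
    · ext z
      change B.str (G.map (i ≫ f) z) = f (i (V.str z))
      rw [hV, hf _ ⟨z, rfl⟩ (hclosed _ ⟨z, rfl⟩), Functor.map_comp_apply]
    · change j ≫ i ≫ f = g
      rw [← hfg]
      rfl
    · intro k hk
      -- Extend `k` to all of `A`, in order to compare it with `f` on the stage `S`.
      obtain ⟨k', hik⟩ := exists_extension (t := i) Subtype.val_injective k.f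
      have hk' : IsSolutionOn A B S k' := by
        rintro _ ⟨w, rfl⟩ -
        change k' (i (V.str w)) = B.str (G.map k' (G.map i w))
        rw [← Functor.map_comp_apply, hik, ← hom_apply, ← hik]
        rfl
      have hfk : t ≫ k' = t ≫ f := by
        rw [hfg, ← hji, Category.assoc, hik]
        exact hk
      ext x
      change k.f x = f (i x)
      rw [← hik]
      exact hS.solution_unique B k' f hk' hf hfk _ x.2

/-- If a coalgebra `P` embeds, by a solution, in an algebra with injective structure map, then
there is a free algebra over `P`: an algebra with a universal solution of `P`. -/
theorem exists_free_algebra_over (hA : Function.Injective A.str) (ht : IsSolution P A t)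
    (hinj : Function.Injective t) :
    ∃ (V : Endofunctor.Algebra G) (j : P.V ⟶ V.a), IsSolution P V j ∧
      ∀ (B : Endofunctor.Algebra G) (g : P.V ⟶ B.a), IsSolution P B g →
        ∃! h : V ⟶ B, j ≫ h.f = g := by
  rcases isEmpty_or_nonempty (G.obj P.V) with hP | hP
  · -- Here `P` itself is empty, and it is the initial algebra.
    have hPV : IsEmpty P.V := Function.isEmpty P.str
    refine ⟨⟨P.V, TypeCat.ofHom fun z => hP.elim z⟩, 𝟙 _, ?_, ?_⟩
    · ext p
      exact hPV.elim p
    · intro B g _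
      refine ⟨⟨g, ?_⟩, ?_, ?_⟩
      · ext z
        exact hP.elim z
      · exact Category.id_comp g
      · intro k _
        ext p
        exact hPV.elim p
  · obtain ⟨S, -, hS⟩ := zorn_subset_nonempty {S | IsStage t S}
      (fun c hc hchain hne => ⟨⋃₀ c, IsStage.sUnion hA hc hchain hne,
        fun _ hs => Set.subset_sUnion_of_mem hs⟩)
      _ (isStage_range hA ht hinj)
    exact hS.1.exists_free_of_closed ht fun z hz =>
      hS.2 (hS.1.image hA) hS.1.subset_image ⟨z, hz, rfl⟩

end Zorn

/-! ### Algebras with generators -/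

/-- The functor `X ↦ H X + Y`, whose algebras are the `H`-algebras with a map from `Y`. -/
def withGenerators (H : Type u ⥤ Type u) (Y : Type u) : Type u ⥤ Type u where
  obj X := H.obj X ⊕ Y
  map f := TypeCat.ofHom (Sum.map (H.map f) id)
  map_id X := by
    refine ConcreteCategory.hom_ext _ _ fun z => ?_
    rcases z with z | y
    · exact congrArg Sum.inl (H.map_id_apply X z)
    · rfl
  map_comp f g := by
    refine ConcreteCategory.hom_ext _ _ fun z => ?_
    rcases z with z | y
    · exact congrArg Sum.inl (H.map_comp_apply f g z)
    · rfl

/-- `V`, with `j : P ⟶ V` and `y : Y ⟶ V`, is the free algebra over the coalgebra `P` on the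
set `Y` of generators. When `P` is empty this is the free algebra on `Y`; when the structure map
of `P` is invertible, `P` is an algebra and `V` is the coproduct of `P` with the free algebra
on `Y`. -/
structure IsFreeOver {H : Type u ⥤ Type u} {Y : Type u} (P : Endofunctor.Coalgebra H)
    (V : Endofunctor.Algebra H) (j : P.V ⟶ V.a) (y : Y ⟶ V.a) : Prop where
  isSolution : IsSolution P V j
  existsUnique : ∀ (B : Endofunctor.Algebra H) (g : P.V ⟶ B.a) (k : Y ⟶ B.a),
    IsSolution P B g → ∃! h : V ⟶ B, j ≫ h.f = g ∧ y ≫ h.f = k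

variable {H : Type u ⥤ Type u} {Y : Type u} {P : Endofunctor.Coalgebra H}

/-- The free algebra on `Y` over an `H`-coalgebra `P` is the free `(H + Y)`-algebra over `P`, seen
as an `(H + Y)`-coalgebra. -/
theorem exists_isFreeOver (A : Endofunctor.Algebra H) (t : P.V ⟶ A.a) (y : Y ⟶ A.a)
    (ht : IsSolution P A t) (hinj : Function.Injective t)
    (hA : Function.Injective (Sum.elim A.str y)) :
    ∃ (V : Endofunctor.Algebra H) (j : P.V ⟶ V.a) (y : Y ⟶ V.a), IsFreeOver P V j y := by
  let G := withGenerators H Y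
  let P' : Endofunctor.Coalgebra G := ⟨P.V, P.str ≫ TypeCat.ofHom Sum.inl⟩
  let toG (B : Endofunctor.Algebra H) (k : Y ⟶ B.a) : Endofunctor.Algebra G :=
    ⟨B.a, TypeCat.ofHom (Sum.elim B.str k)⟩
  obtain ⟨V', j, hj, hV'⟩ := exists_free_algebra_over (G := G) (P := P') (A := toG A y) hA
    (t := t) (ConcreteCategory.hom_ext _ _ fun p => ht.apply p) hinj
  let V : Endofunctor.Algebra H := ⟨V'.a, TypeCat.ofHom Sum.inl ≫ V'.str⟩
  let η : Y ⟶ V.a := TypeCat.ofHom Sum.inr ≫ V'.str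
  refine ⟨V, j, η, ConcreteCategory.hom_ext _ _ fun p => hj.apply p, fun B g k hg => ?_⟩
  have hg' : IsSolution P' (toG B k) g := ConcreteCategory.hom_ext _ _ fun p => hg.apply p
  obtain ⟨h, hh, huniq⟩ := hV' (toG B k) g hg'
  refine ⟨⟨h.f, ConcreteCategory.hom_ext _ _ fun z => (hom_apply h (Sum.inl z)).symm⟩,
    ⟨hh, ConcreteCategory.hom_ext _ _ fun u => hom_apply h (Sum.inr u)⟩, ?_⟩
  rintro l ⟨hl, hl'⟩
  have hlG : (withGenerators H Y).map l.f ≫ (toG B k).str = V'.str ≫ l.f := by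
    refine ConcreteCategory.hom_ext _ _ fun z => ?_
    rcases z with z | u
    · exact (hom_apply l z).symm
    · exact (ConcreteCategory.congr_hom hl' u).symm
  have hlh := congrArg Endofunctor.Algebra.Hom.f (huniq ⟨l.f, hlG⟩ hl)
  exact Endofunctor.Algebra.ext hlh

/-! ### Lambek's lemma -/

/-- The algebra `H A + Y`, in which an element of `H (H A + Y)` is evaluated to `H A`. -/
def unfoldAlgebra (A : Endofunctor.Algebra H) (y : Y ⟶ A.a) : Endofunctor.Algebra H where
  a := H.obj A.a ⊕ Y
  str := H.map (TypeCat.ofHom (Sum.elim A.str y)) ≫ TypeCat.ofHom Sum.inl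

/-- The structure map and the generators of `A` form a homomorphism `H A + Y ⟶ A`. -/
def foldHom (A : Endofunctor.Algebra H) (y : Y ⟶ A.a) : unfoldAlgebra A y ⟶ A where
  f := TypeCat.ofHom (Sum.elim A.str y)
  h := rfl

/-- The coproduct injection of `H A` into the carrier of `unfoldAlgebra A y`. -/
def unfoldInl (A : Endofunctor.Algebra H) (y : Y ⟶ A.a) :
    H.obj A.a ⟶ (unfoldAlgebra A y).a :=
  TypeCat.ofHom Sum.inl

/-- The coproduct injection of `Y` into the carrier of `unfoldAlgebra A y`. -/
def unfoldInr (A : Endofunctor.Algebra H) (y : Y ⟶ A.a) : Y ⟶ (unfoldAlgebra A y).a :=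
  TypeCat.ofHom Sum.inr

theorem unfoldAlgebra_str (A : Endofunctor.Algebra H) (y : Y ⟶ A.a) :
    (unfoldAlgebra A y).str = H.map (foldHom A y).f ≫ unfoldInl A y :=
  rfl

theorem unfoldInl_foldHom (A : Endofunctor.Algebra H) (y : Y ⟶ A.a) :
    unfoldInl A y ≫ (foldHom A y).f = A.str :=
  rfl

theorem unfoldInr_foldHom (A : Endofunctor.Algebra H) (y : Y ⟶ A.a) :
    unfoldInr A y ≫ (foldHom A y).f = y :=
  rfl

/-- Lambek's lemma: a homomorphism `A ⟶ H A + Y` that preserves the generators and is a section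
of the canonical homomorphism is its inverse. -/
theorem bijective_of_section (A : Endofunctor.Algebra H) (y : Y ⟶ A.a)
    (h : A ⟶ unfoldAlgebra A y) (hy : y ≫ h.f = unfoldInr A y)
    (hid : h ≫ foldHom A y = 𝟙 A) : Function.Bijective (Sum.elim A.str y) := by
  have hid' : h.f ≫ (foldHom A y).f = 𝟙 A.a := congrArg Endofunctor.Algebra.Hom.f hid
  have hstr : A.str ≫ h.f = unfoldInl A y := by
    rw [← h.h, unfoldAlgebra_str, ← H.map_comp_assoc, hid', H.map_id, Category.id_comp]
  refine Function.bijective_iff_has_inverse.2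
    ⟨h.f, ?_, fun a => ConcreteCategory.congr_hom hid' a⟩
  rintro (z | u)
  · exact ConcreteCategory.congr_hom hstr z
  · exact ConcreteCategory.congr_hom hy u

theorem IsFreeOver.bijective {V : Endofunctor.Algebra H} {j : P.V ⟶ V.a} {y : Y ⟶ V.a}
    (hV : IsFreeOver P V j y) : Function.Bijective (Sum.elim V.str y) := by
  have hgj : (P.str ≫ H.map j ≫ unfoldInl V y) ≫ (foldHom V y).f = j := by
    rw [Category.assoc, Category.assoc, unfoldInl_foldHom]
    exact hV.isSolution.symm
  have hg : IsSolution P (unfoldAlgebra V y) (P.str ≫ H.map j ≫ unfoldInl V y) := by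
    unfold IsSolution
    rw [unfoldAlgebra_str, ← H.map_comp_assoc, hgj]
  obtain ⟨h, ⟨hj, hy⟩, -⟩ := hV.existsUnique _ _ (unfoldInr V y) hg
  refine bijective_of_section V y h hy ((hV.existsUnique V j y hV.isSolution).unique ?_ ?_)
  · rw [Endofunctor.Algebra.comp_f, reassoc_of% hj, reassoc_of% hy]
    exact ⟨by simpa only [Category.assoc] using hgj, rfl⟩
  · exact ⟨Category.comp_id j, Category.comp_id y⟩

theorem IsFreeAlgebra.bijective {F : Endofunctor.Algebra H} {η : Y ⟶ F.a}
    (hF : IsFreeAlgebra F η) : Function.Bijective (Sum.elim F.str η) := by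
  obtain ⟨h, hη, -⟩ := hF (unfoldAlgebra F η) (unfoldInr F η)
  refine bijective_of_section F η h hη ((hF F η).unique ?_ (Category.comp_id η))
  rw [Endofunctor.Algebra.comp_f, reassoc_of% hη, unfoldInr_foldHom]

/-- A solution in `H A + Y` takes its values in `H A`, and is determined by the solution in `A`
that it induces. -/
theorem IsCorecursive.unfoldAlgebra {A : Endofunctor.Algebra H} (hA : IsCorecursive A)
    (y : Y ⟶ A.a) : IsCorecursive (unfoldAlgebra A y) := by
  intro X
  obtain ⟨s, hs, huniq⟩ := hA X
  refine ⟨X.str ≫ H.map s ≫ unfoldInl A y, ?_, ?_⟩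
  · have hfold : (X.str ≫ H.map s ≫ unfoldInl A y) ≫ (foldHom A y).f = s := by
      rw [Category.assoc, Category.assoc, unfoldInl_foldHom]
      exact hs.symm
    change _ = _
    rw [unfoldAlgebra_str, ← H.map_comp_assoc, hfold]
  · intro r hr
    have hrs : r ≫ (foldHom A y).f = s := huniq _ (IsSolution.comp hr (foldHom A y))
    rw [← hrs, H.map_comp_assoc, ← unfoldAlgebra_str]
    exact hr

theorem IsFreeCorecursiveAlgebra.bijective {M : Endofunctor.Algebra H} {η : Y ⟶ M.a}
    (hM : IsFreeCorecursiveAlgebra M η) : Function.Bijective (Sum.elim M.str η) := by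
  obtain ⟨h, hη, -⟩ := hM.2 (unfoldAlgebra M η) (hM.1.unfoldAlgebra η) (unfoldInr M η)
  refine bijective_of_section M η h hη ((hM.2 M hM.1 η).unique ?_ (Category.comp_id η))
  rw [Endofunctor.Algebra.comp_f, reassoc_of% hη, unfoldInr_foldHom]

/-! ### Large pre-fixpoints -/

/-- If `H A + Y ≅ A`, then `A` is a pre-fixpoint into which `Y` embeds. -/
theorem hasArbitrarilyLargePreFixpoints_of_bijective
    (h : ∀ Y : Type u, ∃ (A : Endofunctor.Algebra H) (y : Y ⟶ A.a),
      Function.Bijective (Sum.elim A.str y)) : HasArbitrarilyLargePreFixpoints H := by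
  intro κ
  obtain ⟨A, y, hA⟩ := h κ.out
  refine ⟨A.a, ?_, A.str, (mono_iff_injective _).2 (hA.1.comp Sum.inl_injective)⟩
  rw [← Cardinal.mk_out κ]
  exact Cardinal.mk_le_of_injective (hA.1.comp Sum.inr_injective)

/-- In the presence of large pre-fixpoints, a coalgebra with injective structure map and any set
of generators embed in an algebra with injective structure map. -/
theorem HasArbitrarilyLargePreFixpoints.exists_embedding
    (hH : HasArbitrarilyLargePreFixpoints H) (P : Endofunctor.Coalgebra H)
    (hP : Function.Injective P.str) (Y : Type u) :
    ∃ (A : Endofunctor.Algebra H) (t : P.V ⟶ A.a) (y : Y ⟶ A.a), IsSolution P A t ∧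
      Function.Injective t ∧ Function.Injective (Sum.elim A.str y) := by
  obtain ⟨K, hK, m, hm⟩ := hH (max Cardinal.aleph0 (max (Cardinal.mk P.V) (Cardinal.mk Y)))
  have hK0 : Cardinal.aleph0 ≤ Cardinal.mk K := (le_max_left _ _).trans hK
  have hKP : Cardinal.mk P.V ≤ Cardinal.mk K :=
    ((le_max_left _ _).trans (le_max_right _ _)).trans hK
  have hKY : Cardinal.mk Y ≤ Cardinal.mk K :=
    ((le_max_right _ _).trans (le_max_right _ _)).trans hK
  have hKK : Cardinal.mk (K ⊕ K) = Cardinal.mk K := by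
    rw [Cardinal.mk_sum, Cardinal.lift_id, Cardinal.add_eq_self hK0]
  obtain ⟨φ⟩ := Cardinal.eq.1 hKK
  obtain ⟨i⟩ := hKP
  obtain ⟨k⟩ := hKY
  -- `P` goes to one half of `K ≃ K ⊕ K`; whatever is not forced by the condition that `t` is a
  -- solution goes to the other half.
  let t : P.V ⟶ K := TypeCat.ofHom fun p => φ (Sum.inl (i p))
  have ht : Function.Injective t := φ.injective.comp (Sum.inl_injective.comp i.injective)
  let e : H.obj K ⊕ Y → K := fun z => φ (Sum.inr (φ (Sum.map m k z)))
  have he : Function.Injective e :=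
    φ.injective.comp (Sum.inr_injective.comp (φ.injective.comp
      (((mono_iff_injective m).1 hm).sumMap k.injective)))
  let q : P.V → H.obj K ⊕ Y := fun p => Sum.inl (H.map t (P.str p))
  have hq : Function.Injective q := by
    intro p p' hpp
    have : Nonempty P.V := ⟨p⟩
    exact hP (map_injective H ht (Sum.inl_injective hpp))
  let f : H.obj K ⊕ Y → K := Function.extend q t e
  have hfq : ∀ p, f (q p) = t p := fun p => hq.extend_apply t e p
  have hfe : ∀ z, (¬∃ p, q p = z) → f z = e z := fun z hz => Function.extend_apply' t e z hz
  have hte : ∀ p z, t p ≠ e z := fun p z h => Sum.inl_ne_inr (φ.injective h)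
  have hf : Function.Injective f := by
    intro z w hzw
    by_cases hz : ∃ p, q p = z <;> by_cases hw : ∃ p, q p = w
    · obtain ⟨p, rfl⟩ := hz
      obtain ⟨p', rfl⟩ := hw
      rw [hfq, hfq] at hzw
      rw [ht hzw]
    · obtain ⟨p, rfl⟩ := hz
      rw [hfq, hfe w hw] at hzw
      exact absurd hzw (hte _ _)
    · obtain ⟨p, rfl⟩ := hw
      rw [hfq, hfe z hz] at hzw
      exact absurd hzw.symm (hte _ _)
    · rw [hfe z hz, hfe w hw] at hzw
      exact he hzw
  refine ⟨⟨K, TypeCat.ofHom fun z => f (Sum.inl z)⟩, t, TypeCat.ofHom fun u => f (Sum.inr u),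
    ConcreteCategory.hom_ext _ _ fun p => (hfq p).symm, ht, ?_⟩
  have hsum : Sum.elim (fun z => f (Sum.inl z)) (fun u => f (Sum.inr u)) = f :=
    Sum.elim_comp_inl_inr f
  intro z w hzw
  refine hf ?_
  rw [← hsum]
  exact hzw

theorem HasArbitrarilyLargePreFixpoints.exists_isFreeOver
    (hH : HasArbitrarilyLargePreFixpoints H) (P : Endofunctor.Coalgebra H)
    (hP : Function.Injective P.str) (Y : Type u) :
    ∃ (V : Endofunctor.Algebra H) (j : P.V ⟶ V.a) (y : Y ⟶ V.a), IsFreeOver P V j y := by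
  obtain ⟨A, t, y, ht, hinj, hA⟩ := hH.exists_embedding P hP Y
  exact SetFunctor.exists_isFreeOver A t y ht hinj hA

/-- `P` embeds in the free algebra over it since it embeds in some algebra. -/
theorem HasArbitrarilyLargePreFixpoints.injective_of_isFreeOver
    (hH : HasArbitrarilyLargePreFixpoints H) (hP : Function.Injective P.str)
    {V : Endofunctor.Algebra H} {j : P.V ⟶ V.a} {y : Y ⟶ V.a} (hV : IsFreeOver P V j y) :
    Function.Injective j := by
  obtain ⟨A, t, k, ht, hinj, -⟩ := hH.exists_embedding P hP Y
  obtain ⟨h, ⟨hj, -⟩, -⟩ := hV.existsUnique A t k ht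
  intro p p' hpp
  refine hinj ?_
  rw [← hj]
  exact congrArg h.f hpp

theorem HasArbitrarilyLargePreFixpoints.hasFreeAlgebras
    (hH : HasArbitrarilyLargePreFixpoints H) : HasFreeAlgebras H := by
  intro Y
  obtain ⟨V, j, y, hV⟩ := hH.exists_isFreeOver
    ⟨PEmpty, TypeCat.ofHom PEmpty.elim⟩ (fun p => p.elim) Y
  refine ⟨V, y, fun B k => ?_⟩
  obtain ⟨h, ⟨-, hk⟩, huniq⟩ := hV.existsUnique B (TypeCat.ofHom PEmpty.elim) k
    (ConcreteCategory.hom_ext _ _ fun p => p.elim)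
  exact ⟨h, hk, fun l hl => huniq l ⟨ConcreteCategory.hom_ext _ _ fun p => p.elim, hl⟩⟩

/-! ### Corecursiveness -/

/-- Induction for free algebras over a coalgebra: a subset that contains the coalgebra and the
generators and is closed under the structure map is the whole algebra. -/
theorem IsFreeOver.induction {V : Endofunctor.Algebra H} {j : P.V ⟶ V.a} {y : Y ⟶ V.a}
    (hV : IsFreeOver P V j y) (S : Set V.a) (hj : ∀ p, j p ∈ S) (hy : ∀ u, y u ∈ S)
    (hS : ∀ z ∈ supportedOn H S, V.str z ∈ S) (v : V.a) : v ∈ S := by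
  let i : (S : Type u) ⟶ V.a := TypeCat.ofHom Subtype.val
  let W : Endofunctor.Algebra H :=
    { a := S
      str := TypeCat.ofHom fun z => ⟨V.str (H.map i z), hS _ ⟨z, rfl⟩⟩ }
  let iHom : W ⟶ V := { f := i, h := rfl }
  let j' : P.V ⟶ W.a := TypeCat.ofHom fun p => ⟨j p, hj p⟩
  have hji : j' ≫ i = j := rfl
  have hj' : IsSolution P W j' := by
    refine ConcreteCategory.hom_ext _ _ fun p => Subtype.ext ?_
    change j p = V.str (H.map i (H.map j' (P.str p)))
    rw [← Functor.map_comp_apply, hji]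
    exact hV.isSolution.apply p
  obtain ⟨h, ⟨h1, h2⟩, -⟩ := hV.existsUnique W j' (TypeCat.ofHom fun u => ⟨y u, hy u⟩) hj'
  have hid : h ≫ iHom = 𝟙 V := by
    refine (hV.existsUnique V j y hV.isSolution).unique ?_
      ⟨Category.comp_id j, Category.comp_id y⟩
    rw [Endofunctor.Algebra.comp_f, reassoc_of% h1, reassoc_of% h2]
    exact ⟨rfl, rfl⟩
  have hv : i (h.f v) = v :=
    ConcreteCategory.congr_hom (congrArg Endofunctor.Algebra.Hom.f hid) v
  rw [← hv]
  exact (h.f v).2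

/-- Every solution `s` in the free algebra over a fixpoint `T` takes its values in `T`. The
elements of `T` and those that are not values of `s` form a subalgebra: if `V.str z` is a value
of `s`, then `z` is supported on the values of `s`, and a retraction which sends these into `T`
shows that `z` is supported on `T` when it is also supported on that subset. -/
theorem IsFreeOver.mem_range_of_isSolution {T : Endofunctor.Coalgebra H} [Nonempty T.V]
    (hT : Function.Surjective T.str)
    {V : Endofunctor.Algebra H} {j : T.V ⟶ V.a} {y : Y ⟶ V.a} (hV : IsFreeOver T V j y)
    {X : Endofunctor.Coalgebra H} {s : X.V ⟶ V.a} (hs : IsSolution X V s) (x : X.V) :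
    s x ∈ Set.range j := by
  classical
  have hinj := hV.bijective.1
  let S : Set V.a := {v | v ∈ Set.range s → v ∈ Set.range j}
  let t₀ : T.V := Classical.arbitrary _
  let r : V.a ⟶ V.a := TypeCat.ofHom fun v => if v ∈ S then v else j t₀
  have hrS : ∀ v ∈ S, r v = (𝟙 V.a : V.a ⟶ V.a) v := fun v hv => if_pos hv
  have hrs : ∀ x, ∃ p, j p = r (s x) := by
    intro x
    by_cases hx : s x ∈ S
    · obtain ⟨p, hp⟩ := hx ⟨x, rfl⟩
      exact ⟨p, hp.trans (if_pos hx).symm⟩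
    · exact ⟨t₀, (if_neg hx).symm⟩
  choose p hp using hrs
  have hfac : s ≫ r = TypeCat.ofHom p ≫ j :=
    ConcreteCategory.hom_ext _ _ fun x => (hp x).symm
  refine hV.induction S (fun p _ => ⟨p, rfl⟩) ?_ ?_ (s x) ⟨x, rfl⟩
  · rintro u ⟨x, hx⟩
    rw [hs.apply x] at hx
    have h := hinj (a₁ := Sum.inl (H.map s (X.str x))) (a₂ := Sum.inr u) hx
    exact absurd h Sum.inl_ne_inr
  · rintro z hz ⟨x, hx⟩
    rw [hs.apply x] at hx
    have hzx : H.map s (X.str x) = z :=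
      Sum.inl_injective (hinj (a₁ := Sum.inl (H.map s (X.str x))) (a₂ := Sum.inl z) hx)
    have hz' : z = H.map j (H.map (TypeCat.ofHom p) (X.str x)) := by
      rw [← Functor.map_comp_apply, ← hfac, Functor.map_comp_apply, hzx,
        map_eq_of_eqOn H hrS hz, Functor.map_id_apply]
    obtain ⟨q, hq⟩ := hT (H.map (TypeCat.ofHom p) (X.str x))
    exact ⟨q, by rw [hV.isSolution.apply q, hq, hz']⟩

/-- A solution with values in a subcoalgebra is a coalgebra homomorphism into it. -/
theorem exists_hom_of_isSolution {T X : Endofunctor.Coalgebra H}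
    (hT : Function.Surjective T.str) {V : Endofunctor.Algebra H} {j : T.V ⟶ V.a}
    (hj : IsSolution T V j) (hinj : Function.Injective j) {s : X.V ⟶ V.a}
    (hs : IsSolution X V s) (hrange : ∀ x, s x ∈ Set.range j) :
    ∃ h : X ⟶ T, h.f ≫ j = s := by
  choose p hp using hrange
  have hfac : TypeCat.ofHom p ≫ j = s := ConcreteCategory.hom_ext _ _ hp
  refine ⟨⟨TypeCat.ofHom p, ConcreteCategory.hom_ext _ _ fun x => ?_⟩, hfac⟩
  obtain ⟨q, hq⟩ := hT (H.map (TypeCat.ofHom p) (X.str x))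
  have hqp : q = p x := by
    refine hinj ?_
    rw [hj.apply q, hq, ← Functor.map_comp_apply, hfac, ← hs.apply x, hp x]
  change H.map (TypeCat.ofHom p) (X.str x) = T.str (p x)
  rw [← hq, hqp]

/-- Composing a coalgebra homomorphism with a solution gives a solution. -/
theorem isSolution_of_coalgebra_hom {T X : Endofunctor.Coalgebra H}
    {V : Endofunctor.Algebra H} {j : T.V ⟶ V.a} (hj : IsSolution T V j) (h : X ⟶ T) :
    IsSolution X V (h.f ≫ j) := by
  unfold IsSolution at *
  nth_rewrite 1 [hj]
  rw [H.map_comp, ← Category.assoc, ← h.h]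
  simp only [Category.assoc]

/-- The free algebra over the terminal coalgebra is corecursive: every coalgebra has its unique
homomorphism into the terminal one as a solution, and every solution is of this form. -/
theorem IsFreeOver.isCorecursive {T : Endofunctor.Coalgebra H} (hT : IsTerminal T)
    {V : Endofunctor.Algebra H} {j : T.V ⟶ V.a} {y : Y ⟶ V.a} (hV : IsFreeOver T V j y)
    (hinj : Function.Injective j) : IsCorecursive V := by
  intro X
  have hTsurj : Function.Surjective T.str :=
    ((isIso_iff_bijective _).1 (Endofunctor.Coalgebra.Terminal.str_isIso hT)).2
  refine ⟨(hT.from X).f ≫ j, isSolution_of_coalgebra_hom hV.isSolution _, ?_⟩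
  intro s hs
  rcases isEmpty_or_nonempty X.V with hX | ⟨⟨x₀⟩⟩
  · exact ConcreteCategory.hom_ext _ _ fun x => hX.elim x
  · have : Nonempty T.V := ⟨(hT.from X).f x₀⟩
    obtain ⟨h, rfl⟩ := exists_hom_of_isSolution hTsurj hV.isSolution hinj hs
      (hV.mem_range_of_isSolution hTsurj hs)
    rw [hT.hom_ext h (hT.from X)]

/-! ### The coproduct of the terminal coalgebra with a free algebra -/

theorem isSolution_iff {T : Endofunctor.Coalgebra H} {i : H.obj T.V ⟶ T.V}
    (h1 : T.str ≫ i = 𝟙 T.V) (h2 : i ≫ T.str = 𝟙 (H.obj T.V)) {B : Endofunctor.Algebra H}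
    (g : T.V ⟶ B.a) : IsSolution T B g ↔ H.map g ≫ B.str = i ≫ g := by
  unfold IsSolution
  constructor
  · intro h
    nth_rewrite 2 [h]
    rw [reassoc_of% h2]
  · intro h
    rw [h, reassoc_of% h1]

/-- The homomorphisms from the terminal coalgebra, considered as an algebra, are the solutions
of this coalgebra. -/
theorem isSolution_iff_hom {T : Endofunctor.Coalgebra H} (hT : IsTerminal T)
    {B : Endofunctor.Algebra H} (g : T.V ⟶ B.a) :
    IsSolution T B g ↔ H.map g ≫ B.str = (terminalAlgebra hT).str ≫ g :=
  isSolution_iff (Endofunctor.Coalgebra.Terminal.right_inv hT)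
    (Endofunctor.Coalgebra.Terminal.left_inv hT) g

theorem isFreeOver_of_isColimit {T : Endofunctor.Coalgebra H} (hT : IsTerminal T)
    {F : Endofunctor.Algebra H} {η : Y ⟶ F.a} (hF : IsFreeAlgebra F η)
    {c : BinaryCofan (terminalAlgebra hT) F} (hc : IsColimit c) :
    IsFreeOver T c.pt c.inl.f (η ≫ c.inr.f) where
  isSolution := (isSolution_iff_hom hT _).2 c.inl.h
  existsUnique B g k hg := by
    let gHom : terminalAlgebra hT ⟶ B := ⟨g, (isSolution_iff_hom hT g).1 hg⟩
    obtain ⟨kHom, hk, hkuniq⟩ := hF B k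
    obtain ⟨h, h1, h2⟩ := BinaryCofan.IsColimit.desc' hc gHom kHom
    refine ⟨h, ⟨congrArg Endofunctor.Algebra.Hom.f h1,
      (congrArg (fun m : F ⟶ B => η ≫ m.f) h2).trans hk⟩, ?_⟩
    · rintro l ⟨hl1, hl2⟩
      refine BinaryCofan.IsColimit.hom_ext hc ?_ ?_
      · rw [h1]
        exact Endofunctor.Algebra.ext hl1
      · rw [h2]
        exact hkuniq _ hl2

theorem IsFreeOver.hasBinaryCoproduct {T : Endofunctor.Coalgebra H} (hT : IsTerminal T)
    {F : Endofunctor.Algebra H} {η : Y ⟶ F.a} (hF : IsFreeAlgebra F η)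
    {V : Endofunctor.Algebra H} {j : T.V ⟶ V.a} {y : Y ⟶ V.a} (hV : IsFreeOver T V j y) :
    HasBinaryCoproduct (terminalAlgebra hT) F := by
  let jHom : terminalAlgebra hT ⟶ V := ⟨j, (isSolution_iff_hom hT j).1 hV.isSolution⟩
  obtain ⟨r, hr, -⟩ := hF V y
  have hdesc : ∀ s : BinaryCofan (terminalAlgebra hT) F,
      ∃! h : V ⟶ s.pt, j ≫ h.f = s.inl.f ∧ y ≫ h.f = η ≫ s.inr.f := fun s =>
    hV.existsUnique s.pt s.inl.f (η ≫ s.inr.f) ((isSolution_iff_hom hT _).2 s.inl.h)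
  choose d hd huniq using hdesc
  refine ⟨⟨⟨BinaryCofan.mk jHom r, BinaryCofan.isColimitMk d ?_ ?_ ?_⟩⟩⟩
  · intro s
    exact Endofunctor.Algebra.ext (hd s).1
  · intro s
    refine (hF s.pt (η ≫ s.inr.f)).unique ?_ rfl
    rw [Endofunctor.Algebra.comp_f, reassoc_of% hr]
    exact (hd s).2
  · intro s l hl1 hl2
    refine huniq s l ⟨congrArg Endofunctor.Algebra.Hom.f hl1, ?_⟩
    rw [← hl2, ← hr, Category.assoc]
    rfl

/-- Over the terminal coalgebra `T`, the universal property of the free algebra becomes that of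
the free corecursive algebra, since `T` has a unique solution in every corecursive algebra. -/
theorem IsFreeOver.isFreeCorecursiveAlgebra {T : Endofunctor.Coalgebra H} (hT : IsTerminal T)
    {V : Endofunctor.Algebra H} {j : T.V ⟶ V.a} {y : Y ⟶ V.a} (hV : IsFreeOver T V j y)
    (hinj : Function.Injective j) : IsFreeCorecursiveAlgebra V y := by
  refine ⟨hV.isCorecursive hT hinj, fun B hB k => ?_⟩
  obtain ⟨g, hg, hguniq⟩ := hB T
  obtain ⟨h, ⟨-, hk⟩, huniq⟩ := hV.existsUnique B g k hg
  exact ⟨h, hk, fun l hl => huniq l ⟨hguniq _ (hV.isSolution.comp l), hl⟩⟩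

/-! ### Corecursive fixpoints -/

/-- A corecursive fixpoint, inverted, is a terminal coalgebra: the solutions in it are the
coalgebra homomorphisms. -/
theorem HasCorecursiveFixpoint.hasTerminal (h : HasCorecursiveFixpoint H) :
    HasTerminal (Endofunctor.Coalgebra H) := by
  obtain ⟨A, hA, hcor⟩ := h
  let T : Endofunctor.Coalgebra H := ⟨A.a, inv A.str⟩
  have hsol : ∀ (X : Endofunctor.Coalgebra H) (s : X.V ⟶ A.a),
      s = X.str ≫ H.map s ≫ A.str ↔ X.str ≫ H.map s = s ≫ inv A.str := by
    intro X s
    rw [← Category.assoc, ← IsIso.comp_inv_eq, eq_comm]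
  choose s hs huniq using hcor
  refine IsTerminal.hasTerminal (X := T) (IsTerminal.ofUniqueHom
    (fun X => ⟨s X, (hsol X _).1 (hs X)⟩) fun X m => ?_)
  exact Endofunctor.Coalgebra.ext (huniq X m.f ((hsol X m.f).2 m.h))

theorem hasCorecursiveFixpoint_of_isTerminal {T : Endofunctor.Coalgebra H} (hT : IsTerminal T) :
    HasCorecursiveFixpoint H := by
  refine ⟨terminalAlgebra hT, ⟨T.str, Endofunctor.Coalgebra.Terminal.left_inv hT,
    Endofunctor.Coalgebra.Terminal.right_inv hT⟩, fun X => ?_⟩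
  have hid' : 𝟙 T.V = T.str ≫ H.map (𝟙 T.V) ≫ Endofunctor.Coalgebra.Terminal.strInv hT := by
    rw [H.map_id, Category.id_comp, Endofunctor.Coalgebra.Terminal.right_inv]
  have hid : IsSolution T (terminalAlgebra hT) (𝟙 T.V) := hid'
  have hTsurj : Function.Surjective T.str :=
    ((isIso_iff_bijective _).1 (Endofunctor.Coalgebra.Terminal.str_isIso hT)).2
  refine ⟨(hT.from X).f, isSolution_of_coalgebra_hom hid (hT.from X), fun s hs => ?_⟩
  obtain ⟨h, rfl⟩ := exists_hom_of_isSolution hTsurj hid (fun _ _ h => h) hs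
    fun x => ⟨s x, rfl⟩
  rw [hT.hom_ext h (hT.from X)]
  rfl

/-- The initial corecursive algebra is a fixpoint, by Lambek's lemma. -/
theorem HasFreeCorecursiveAlgebras.hasCorecursiveFixpoint (h : HasFreeCorecursiveAlgebras H) :
    HasCorecursiveFixpoint H := by
  obtain ⟨M, η, hM⟩ := h PEmpty
  refine ⟨M, (isIso_iff_bijective _).2 ⟨hM.bijective.1.comp Sum.inl_injective, fun a => ?_⟩, hM.1⟩
  obtain ⟨z | u, hz⟩ := hM.bijective.2 a
  · exact ⟨z, hz⟩
  · exact u.elim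

theorem HasArbitrarilyLargePreFixpoints.coproduct_isFreeCorecursiveAlgebra
    (hH : HasArbitrarilyLargePreFixpoints H) {T : Endofunctor.Coalgebra H} (hT : IsTerminal T)
    {F : Endofunctor.Algebra H} {η : Y ⟶ F.a} (hF : IsFreeAlgebra F η) :
    HasBinaryCoproduct (terminalAlgebra hT) F ∧
      ∀ c : BinaryCofan (terminalAlgebra hT) F, IsColimit c →
        IsFreeCorecursiveAlgebra c.pt (η ≫ c.inr.f) := by
  have hTinj : Function.Injective T.str :=
    ((isIso_iff_bijective _).1 (Endofunctor.Coalgebra.Terminal.str_isIso hT)).1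
  refine ⟨?_, fun c hc => ?_⟩
  · obtain ⟨V, j, y, hV⟩ := hH.exists_isFreeOver T hTinj Y
    exact hV.hasBinaryCoproduct hT hF
  · have hV := isFreeOver_of_isColimit hT hF hc
    exact hV.isFreeCorecursiveAlgebra hT (hH.injective_of_isFreeOver hTinj hV)

end SetFunctor

theorem mainTheorem2 (H : Type u ⥤ Type u) :
    List.TFAE
      [SetFunctor.HasFreeCorecursiveAlgebras H,
       SetFunctor.HasFreeAlgebras H ∧ HasTerminal (Endofunctor.Coalgebra H),
       SetFunctor.HasArbitrarilyLargePreFixpoints H ∧ SetFunctor.HasCorecursiveFixpoint H] ∧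
    (SetFunctor.HasFreeCorecursiveAlgebras H →
      ∀ (T : Endofunctor.Coalgebra H) (hT : IsTerminal T)
        (Y : Type u) (F : Endofunctor.Algebra H) (η : Y ⟶ F.a),
        SetFunctor.IsFreeAlgebra F η →
          HasBinaryCoproduct (SetFunctor.terminalAlgebra hT) F ∧
          ∀ c : BinaryCofan (SetFunctor.terminalAlgebra hT) F, IsColimit c →
            SetFunctor.IsFreeCorecursiveAlgebra c.pt (η ≫ c.inr.f)) := by
  have large_of_corec : SetFunctor.HasFreeCorecursiveAlgebras H →
      SetFunctor.HasArbitrarilyLargePreFixpoints H := fun h =>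
    SetFunctor.hasArbitrarilyLargePreFixpoints_of_bijective fun Y =>
      let ⟨M, η, hM⟩ := h Y
      ⟨M, η, hM.bijective⟩
  have large_of_free : SetFunctor.HasFreeAlgebras H →
      SetFunctor.HasArbitrarilyLargePreFixpoints H := fun h =>
    SetFunctor.hasArbitrarilyLargePreFixpoints_of_bijective fun Y =>
      let ⟨F, η, hF⟩ := h Y
      ⟨F, η, hF.bijective⟩
  refine ⟨?_, fun h T hT Y F η hF =>
    (large_of_corec h).coproduct_isFreeCorecursiveAlgebra hT hF⟩
  tfae_have 1 → 3 := fun h => ⟨large_of_corec h, h.hasCorecursiveFixpoint⟩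
  tfae_have 3 → 2 := fun h => ⟨h.1.hasFreeAlgebras, h.2.hasTerminal⟩
  tfae_have 2 → 3 := fun h =>
    ⟨large_of_free h.1, have := h.2; SetFunctor.hasCorecursiveFixpoint_of_isTerminal
      terminalIsTerminal⟩
  tfae_have 2 → 1 := by
    rintro ⟨hfree, hterm⟩ Y
    obtain ⟨F, η, hF⟩ := hfree Y
    obtain ⟨hcop, hcor⟩ := (large_of_free hfree).coproduct_isFreeCorecursiveAlgebra
      (terminalIsTerminal (C := Endofunctor.Coalgebra H)) hF
    exact ⟨_, _, hcor _ (colimit.isColimit _)⟩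
  tfae_finish
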